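/- Let $X$ be an abstract simplicial complex of dimension $2$ that is pure (all its facets, i.e. maximal faces, have the same dimension, so that every facet is a triangle). Suppose that $H_1(L)=0$ for every subcomplex $L\subseteq X$ that is pure of dimension $2$, where $H_1$ denotes simplicial homology with integer coefficients. Then, for every choice of orientations of the edges and of the triangles of $X$, the matrix $[\partial_2]$ of the boundary operator $\partial_2\colon C_2(X)\to C_1(X)$ with respect to the bases given by the oriented triangles and the oriented edges is totally unimodular, i.e. each of its finite square submatrices has determinant $0$, $1$ or $-1$. -/

import Mathlib

noncomputable section

namespace PreAbstractSimplicialComplex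

universe u

variable {V : Type u}

/-- The dimension `|s| - 1` of a simplex `s`. -/
def simplexDim (s : Finset V) : ℤ := (s.card : ℤ) - 1

/-- The facets of `X` are its maximal faces. -/
def IsFacet (X : PreAbstractSimplicialComplex V) (s : Finset V) : Prop :=
  Maximal (fun t => t ∈ X.faces) s

/-- `X` is pure: all its facets have the same dimension. -/
def IsPure (X : PreAbstractSimplicialComplex V) : Prop :=
  ∀ s t : Finset V, X.IsFacet s → X.IsFacet t → simplexDim s = simplexDim t

/-- `X` has dimension `d`: the maximum of the dimensions of its faces is `d`. -/
def HasDim (X : PreAbstractSimplicialComplex V) (d : ℕ) : Prop :=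
  IsGreatest (simplexDim '' X.faces) (d : ℤ)

/-- `X^{(d)}`, the set of `d`-dimensional simplices of `X`. -/
def Simplex (X : PreAbstractSimplicialComplex V) (d : ℕ) : Type u :=
  {s : Finset V // s ∈ X.faces ∧ s.card = d + 1}

/-- The vertex set of an ordered tuple of distinct vertices. -/
def support {n : ℕ} (f : Fin n ↪ V) : Finset V := Finset.univ.map f

theorem support_trans {n : ℕ} (σ : Equiv.Perm (Fin n)) (f : Fin n ↪ V) :
    support (σ.toEmbedding.trans f) = support f := by
  ext v
  simp only [support, Finset.mem_map, Finset.mem_univ, true_and]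
  constructor
  · rintro ⟨i, rfl⟩
    exact ⟨σ i, rfl⟩
  · rintro ⟨i, rfl⟩
    exact ⟨σ.symm i, by simp⟩

/-- The orderings `[v_0, …, v_d]` of the `d`-dimensional simplices of `X`. -/
def Ordering (X : PreAbstractSimplicialComplex V) (d : ℕ) : Type u :=
  {f : Fin (d + 1) ↪ V // support f ∈ X.faces}

variable {X : PreAbstractSimplicialComplex V}

/-- The simplex underlying an ordering. -/
def Ordering.simplex {d : ℕ} (f : X.Ordering d) : X.Simplex d :=
  ⟨support f.1, f.2, by simp [support]⟩

/-- The ordering `[v_{σ(0)}, …, v_{σ(d)}]`. -/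
def Ordering.perm {d : ℕ} (f : X.Ordering d) (σ : Equiv.Perm (Fin (d + 1))) : X.Ordering d :=
  ⟨σ.toEmbedding.trans f.1, by rw [support_trans]; exact f.2⟩

/-- The ordering obtained by deleting the vertex `v_i`. -/
def Ordering.delete {d : ℕ} (f : X.Ordering (d + 1)) (i : Fin (d + 2)) : X.Ordering d :=
  ⟨i.succAboveEmb.trans f.1, by
    refine (X.isRelLowerSet_faces f.2).2 ?_ (by simp [support])
    intro v hv
    simp only [support, Finset.mem_map, Finset.mem_univ, true_and] at hv ⊢
    obtain ⟨j, rfl⟩ := hv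
    exact ⟨_, rfl⟩⟩

/-- The relations `[v_{σ(0)}, …, v_{σ(d)}] = sign(σ) [v_0, …, v_d]`. -/
def orientationRelations (X : PreAbstractSimplicialComplex V) (d : ℕ) :
    Submodule ℤ (X.Ordering d →₀ ℤ) :=
  Submodule.span ℤ (Set.range fun p : X.Ordering d × Equiv.Perm (Fin (d + 1)) =>
    Finsupp.single (p.1.perm p.2) 1 - Finsupp.single p.1 (Equiv.Perm.sign p.2 : ℤ))

/-- The group `C_d(X)` of oriented `d`-chains. -/
abbrev Chain (X : PreAbstractSimplicialComplex V) (d : ℕ) : Type u :=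
  (X.Ordering d →₀ ℤ) ⧸ X.orientationRelations d

/-- The class in `C_d(X)` of an ordering of a `d`-simplex. -/
def Ordering.toChain {d : ℕ} (f : X.Ordering d) : X.Chain d :=
  (X.orientationRelations d).mkQ (Finsupp.single f 1)

theorem Ordering.toChain_perm {d : ℕ} (f : X.Ordering d) (σ : Equiv.Perm (Fin (d + 1))) :
    (f.perm σ).toChain = (Equiv.Perm.sign σ : ℤ) • f.toChain := by
  have h : Finsupp.single (f.perm σ) 1 - Finsupp.single f (Equiv.Perm.sign σ : ℤ) ∈
      X.orientationRelations d := Submodule.subset_span ⟨(f, σ), rfl⟩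
  rw [Ordering.toChain, Ordering.toChain, ← map_smul, ← sub_eq_zero, ← map_sub,
    Finsupp.smul_single, smul_eq_mul, mul_one]
  exact (Submodule.Quotient.mk_eq_zero _).2 h

/-- A map on orderings that respects the orientation relations extends to chains. -/
def Chain.lift {M : Type*} [AddCommGroup M] {d : ℕ} (φ : X.Ordering d → M)
    (hφ : ∀ f σ, φ (f.perm σ) = (Equiv.Perm.sign σ : ℤ) • φ f) : X.Chain d →ₗ[ℤ] M :=
  (X.orientationRelations d).liftQ (Finsupp.linearCombination ℤ φ) (by
    rw [orientationRelations, Submodule.span_le]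
    rintro _ ⟨⟨f, σ⟩, rfl⟩
    simp [hφ])

theorem Chain.lift_toChain {M : Type*} [AddCommGroup M] {d : ℕ} (φ : X.Ordering d → M)
    (hφ : ∀ f σ, φ (f.perm σ) = (Equiv.Perm.sign σ : ℤ) • φ f) (f : X.Ordering d) :
    Chain.lift φ hφ f.toChain = φ f := by
  simp [Chain.lift, Ordering.toChain]

theorem Chain.hom_ext {M : Type*} [AddCommGroup M] {d : ℕ} {a b : X.Chain d →ₗ[ℤ] M}
    (h : ∀ f : X.Ordering d, a f.toChain = b f.toChain) : a = b := by
  refine Submodule.linearMap_qext _ (Finsupp.lhom_ext' fun f => LinearMap.ext_ring ?_)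
  exact h f

/-- Deleting the `i`-th entry of a permuted tuple is the same as permuting the tuple with
its `σ i`-th entry deleted. -/
theorem exists_perm_succAbove {n : ℕ} (σ : Equiv.Perm (Fin (n + 1))) (i : Fin (n + 1)) :
    ∃ τ : Equiv.Perm (Fin n), (∀ j, (σ i).succAbove (τ j) = σ (i.succAbove j)) ∧
      (Equiv.Perm.sign τ : ℤ) =
        (-1) ^ (i : ℕ) * (-1) ^ (σ i : ℕ) * (Equiv.Perm.sign σ : ℤ) := by
  set ρ : Equiv.Perm (Fin (n + 1)) := (σ i).cycleRange * σ * i.cycleRange⁻¹ with hρ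
  obtain ⟨⟨p, τ⟩, hp⟩ := Equiv.Perm.decomposeFin.symm.surjective ρ
  have h0 : ρ 0 = 0 := by
    simp only [hρ, Equiv.Perm.mul_apply, Equiv.Perm.inv_def, Fin.cycleRange_symm_zero,
      Fin.cycleRange_self]
  have hp0 : p = 0 := by
    rw [← hp, Equiv.Perm.decomposeFin_symm_apply_zero] at h0
    exact h0
  subst hp0
  refine ⟨τ, fun j => ?_, ?_⟩
  · have h1 : (τ j).succ = (σ i).cycleRange (σ (i.succAbove j)) := by
      have h2 : ρ j.succ = (τ j).succ := by
        rw [← hp, Equiv.Perm.decomposeFin_symm_apply_succ]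
        simp
      rw [← h2]
      simp only [hρ, Equiv.Perm.mul_apply, Equiv.Perm.inv_def, Fin.cycleRange_symm_succ]
    rw [← Fin.cycleRange_symm_succ, h1, Equiv.symm_apply_apply]
  · have h3 : Equiv.Perm.sign ρ = Equiv.Perm.sign τ := by
      rw [← hp, Equiv.Perm.decomposeFin.symm_sign]
      simp
    rw [← h3, hρ]
    simp only [map_mul, Equiv.Perm.sign_inv, Fin.sign_cycleRange]
    push_cast
    ring

/-- The boundary map `∂_{d+1} : C_{d+1}(X) → C_d(X)`,
`[v_0, …, v_{d+1}] ↦ ∑ i, (-1)^i [v_0, …, v̂_i, …, v_{d+1}]`. -/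
def boundary (X : PreAbstractSimplicialComplex V) (d : ℕ) :
    X.Chain (d + 1) →ₗ[ℤ] X.Chain d :=
  Chain.lift (fun f => ∑ i : Fin (d + 2), (-1 : ℤ) ^ (i : ℕ) • (f.delete i).toChain) (by
    intro f σ
    rw [← Equiv.sum_comp σ fun i => (-1 : ℤ) ^ (i : ℕ) • (f.delete i).toChain,
      Finset.smul_sum]
    refine Finset.sum_congr rfl fun i _ => ?_
    obtain ⟨τ, h, hs⟩ := exists_perm_succAbove σ i
    have hd : (f.perm σ).delete i = (f.delete (σ i)).perm τ :=
      Subtype.ext (Function.Embedding.ext fun j => congrArg f.1 (h j).symm)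
    rw [hd, Ordering.toChain_perm, hs, smul_smul, smul_smul]
    congr 1
    have h1 : ((-1 : ℤ) ^ (i : ℕ)) * (-1) ^ (i : ℕ) = 1 := by
      rw [← mul_pow]; simp
    linear_combination ((-1 : ℤ) ^ (σ i : ℕ) * (Equiv.Perm.sign σ : ℤ)) * h1)

theorem boundary_toChain (d : ℕ) (f : X.Ordering (d + 1)) :
    X.boundary d f.toChain =
      ∑ i : Fin (d + 2), (-1 : ℤ) ^ (i : ℕ) • (f.delete i).toChain :=
  Chain.lift_toChain _ _ f

theorem boundary_comp_boundary (X : PreAbstractSimplicialComplex V) (d : ℕ) :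
    X.boundary d ∘ₗ X.boundary (d + 1) = 0 := by
  refine Chain.hom_ext fun f => ?_
  simp only [LinearMap.comp_apply, boundary_toChain, map_sum, map_smul, LinearMap.zero_apply,
    Finset.smul_sum, Fin.sum_sum_eq_sum_triangle_add, smul_smul]
  refine Finset.sum_eq_zero fun i _ => Finset.sum_eq_zero fun j hj => ?_
  rw [Finset.mem_Ici] at hj
  have hd : (f.delete i.castSucc).delete j = (f.delete j.succ).delete i := by
    refine Subtype.ext (Function.Embedding.ext fun k => congrArg f.1 ?_)
    change i.castSucc.succAbove (j.succAbove k) = j.succ.succAbove (i.succAbove k)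
    have := Fin.succAbove_succAbove_succAbove_predAbove i.castSucc j k
    simpa [Fin.succAbove_of_le_castSucc, hj, Fin.predAbove, hj.not_gt] using this.symm
  rw [hd, ← add_smul]
  simp [pow_succ, mul_comm]

/-- The group `Z_d(X)` of `d`-cycles. -/
def cycles (X : PreAbstractSimplicialComplex V) : (d : ℕ) → Submodule ℤ (X.Chain d)
  | 0 => ⊤
  | d + 1 => LinearMap.ker (X.boundary d)

/-- The group `B_d(X)` of `d`-boundaries. -/
def boundaries (X : PreAbstractSimplicialComplex V) (d : ℕ) : Submodule ℤ (X.Chain d) :=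
  LinearMap.range (X.boundary d)

theorem boundaries_le_cycles (X : PreAbstractSimplicialComplex V) (d : ℕ) :
    X.boundaries d ≤ X.cycles d := by
  cases d with
  | zero => exact le_top
  | succ d => exact LinearMap.range_le_ker_iff.2 (X.boundary_comp_boundary d)

/-- The homology group `H_d(X) = Z_d(X) / B_d(X)` with integer coefficients. -/
abbrev Homology (X : PreAbstractSimplicialComplex V) (d : ℕ) : Type u :=
  X.cycles d ⧸ (X.boundaries d).submoduleOf (X.cycles d)

/-- A choice of an orientation of every `d`-simplex of `X`, each given by an ordering of the
vertices that represents it. -/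
def Orientation (X : PreAbstractSimplicialComplex V) (d : ℕ) : Type u :=
  (s : X.Simplex d) → {f : X.Ordering d // f.simplex = s}

theorem exists_relPerm {d : ℕ} (f g : X.Ordering d) (h : f.simplex = g.simplex) :
    ∃ σ : Equiv.Perm (Fin (d + 1)), f.perm σ = g := by
  have hs : support f.1 = support g.1 := congrArg Subtype.val h
  have hr : ∀ i, ∃ j, f.1 j = g.1 i := fun i => by
    have hi : g.1 i ∈ support f.1 := by rw [hs]; simp [support]
    simpa [support] using hi
  choose r hr using hr
  have hinj : Function.Injective r := fun a b hab => g.1.injective (by rw [← hr, ← hr, hab])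
  exact ⟨Equiv.ofBijective r (Finite.injective_iff_bijective.1 hinj),
    Subtype.ext (Function.Embedding.ext hr)⟩

theorem Ordering.perm_injective {d : ℕ} (f : X.Ordering d) : Function.Injective f.perm := by
  intro σ τ h
  refine Equiv.ext fun i => f.1.injective ?_
  exact DFunLike.congr_fun (congrArg Subtype.val h) i

theorem Ordering.simplex_perm {d : ℕ} (f : X.Ordering d) (σ : Equiv.Perm (Fin (d + 1))) :
    (f.perm σ).simplex = f.simplex :=
  Subtype.ext (support_trans σ f.1)

/-- The permutation that takes the chosen ordering of the simplex of `f` to `f`. -/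
def Orientation.relPerm {d : ℕ} (o : X.Orientation d) (f : X.Ordering d) :
    Equiv.Perm (Fin (d + 1)) :=
  (exists_relPerm (o f.simplex).1 f (o f.simplex).2).choose

theorem Orientation.perm_relPerm {d : ℕ} (o : X.Orientation d) (f : X.Ordering d) :
    (o f.simplex).1.perm (o.relPerm f) = f :=
  (exists_relPerm (o f.simplex).1 f (o f.simplex).2).choose_spec

theorem Orientation.relPerm_eq {d : ℕ} (o : X.Orientation d) (f : X.Ordering d)
    (σ : Equiv.Perm (Fin (d + 1))) (h : (o f.simplex).1.perm σ = f) : o.relPerm f = σ :=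
  Ordering.perm_injective _ ((o.perm_relPerm f).trans h.symm)

theorem Orientation.relPerm_perm {d : ℕ} (o : X.Orientation d) (f : X.Ordering d)
    (σ : Equiv.Perm (Fin (d + 1))) : o.relPerm (f.perm σ) = o.relPerm f * σ := by
  apply o.relPerm_eq
  rw [f.simplex_perm]
  conv_rhs => rw [← o.perm_relPerm f]
  rfl

/-- The coordinates of a chain with respect to the chosen oriented simplices. -/
def Orientation.repr {d : ℕ} (o : X.Orientation d) : X.Chain d →ₗ[ℤ] (X.Simplex d →₀ ℤ) :=
  Chain.lift (fun f => Finsupp.single f.simplex (Equiv.Perm.sign (o.relPerm f) : ℤ)) (by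
    intro f σ
    rw [f.simplex_perm, o.relPerm_perm, Finsupp.smul_single, smul_eq_mul, map_mul,
      Units.val_mul, mul_comm])

/-- The chosen oriented `d`-simplices form a basis of `C_d(X)`. -/
def Orientation.basis {d : ℕ} (o : X.Orientation d) : Module.Basis (X.Simplex d) ℤ (X.Chain d) :=
  Module.Basis.ofRepr (LinearEquiv.ofLinearMap o.repr
    (Finsupp.linearCombination ℤ fun s => (o s).1.toChain)
    (by
      refine Finsupp.lhom_ext' fun s => LinearMap.ext_ring ?_
      have hs : (o s).1.simplex = s := (o s).2
      have h1 : o.relPerm (o s).1 = 1 := by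
        apply o.relPerm_eq
        rw [hs]
        rfl
      simp [Orientation.repr, Chain.lift_toChain, h1, hs])
    (by
      refine Chain.hom_ext fun f => ?_
      simp only [Orientation.repr, LinearMap.comp_apply, Chain.lift_toChain,
        Finsupp.linearCombination_single, LinearMap.id_apply]
      rw [← Ordering.toChain_perm, o.perm_relPerm]))

theorem Orientation.basis_apply {d : ℕ} (o : X.Orientation d) (s : X.Simplex d) :
    o.basis s = (o s).1.toChain := by
  rw [Module.Basis.apply_eq_iff]
  have hs : (o s).1.simplex = s := (o s).2
  have h1 : o.relPerm (o s).1 = 1 := by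
    apply o.relPerm_eq
    rw [hs]
    rfl
  change o.repr _ = _
  simp [Orientation.repr, Chain.lift_toChain, h1, hs]

/-- The matrix `[∂_{d+1}]` of the boundary map with respect to the bases of oriented simplices
given by chosen orientations: rows are indexed by `d`-simplices, columns by `(d+1)`-simplices,
and the column of `t` consists of the coordinates of `∂ t`. -/
def boundaryMatrix (X : PreAbstractSimplicialComplex V) (d : ℕ)
    (o : X.Orientation d) (o' : X.Orientation (d + 1)) :
    Matrix (X.Simplex d) (X.Simplex (d + 1)) ℤ :=
  Matrix.of fun s t => o.basis.repr (X.boundary d (o'.basis t)) s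

end PreAbstractSimplicialComplex

end

noncomputable section

namespace PreAbstractSimplicialComplex

universe u

variable {V : Type u} {X L : PreAbstractSimplicialComplex V}

/-! Let `B` be a square submatrix with nonzero determinant, and let `L` be the complex generated by
its column triangles. `L` is pure of dimension 2, contains every row edge (no row of `B` vanishes),
and has no triangles besides the columns, so `H_1(L) = 0` applies and `B` may be studied inside `L`.
It suffices that `B` is surjective over ℤ. Given a chain `Y` on the row edges, Cramer's rule makes
`det B • Y` a boundary up to a chain on the remaining edges. Hence `det B • ∂Y` is a boundary in the
graph of the remaining edges. Since `H_0` of a graph is torsion-free, `∂Y = ∂W` with `W` supported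
off the rows. The cycle `Y - W` bounds because `H_1(L) = 0`, and the coefficients of a bounding
2-chain solve the system. The two halves are `mem_span_boundary_of_smul_mem` and
`isUnit_det_submatrix_boundaryMatrix`. -/

theorem boundary_zero_toChain (f : X.Ordering 1) :
    X.boundary 0 f.toChain = (f.delete 0).toChain - (f.delete 1).toChain := by
  rw [boundary_toChain, Fin.sum_univ_two]
  simp [sub_eq_add_neg]

/-- The zeroth homology of a graph with a set `O` of oriented edges is torsion-free. -/
theorem mem_span_boundary_of_smul_mem {O : Set (X.Ordering 1)} {n : ℤ} (hn : n ≠ 0)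
    {c : X.Chain 0}
    (h : n • c ∈ Submodule.span ℤ ((fun f : X.Ordering 1 => X.boundary 0 f.toChain) '' O)) :
    c ∈ Submodule.span ℤ ((fun f : X.Ordering 1 => X.boundary 0 f.toChain) '' O) := by
  set M := Submodule.span ℤ ((fun f : X.Ordering 1 => X.boundary 0 f.toChain) '' O) with hM
  -- `Quot r` is the set of connected components of the graph. The map `φ` to the free group on it
  -- has kernel exactly `M`: it kills `M`, and `ψ` recovers the class modulo `M` from it.
  let r : X.Ordering 0 → X.Ordering 0 → Prop :=
    fun f g => ∃ e ∈ O, e.delete 0 = f ∧ e.delete 1 = g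
  let φ : X.Chain 0 →ₗ[ℤ] (Quot r →₀ ℤ) :=
    Chain.lift (fun f => Finsupp.single (Quot.mk r f) 1) (by
      intro f σ
      obtain rfl : σ = 1 := Subsingleton.elim (α := Equiv.Perm (Fin 1)) _ _
      have h1 : f.perm 1 = f := rfl
      simp [h1])
  let ψ : (Quot r →₀ ℤ) →ₗ[ℤ] X.Chain 0 ⧸ M :=
    Finsupp.linearCombination ℤ (Quot.lift (fun f => M.mkQ f.toChain) (by
      rintro _ _ ⟨e, he, rfl, rfl⟩
      rw [← sub_eq_zero, ← map_sub, ← boundary_zero_toChain]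
      exact (Submodule.Quotient.mk_eq_zero _).2 (Submodule.subset_span ⟨e, he, rfl⟩)))
  have hψφ : ψ ∘ₗ φ = M.mkQ := by
    refine Chain.hom_ext fun f => ?_
    simp [ψ, φ, Chain.lift_toChain]
  have hφM : M ≤ LinearMap.ker φ := by
    rw [hM, Submodule.span_le]
    rintro _ ⟨e, he, rfl⟩
    have hr : Quot.mk r (e.delete 0) = Quot.mk r (e.delete 1) := Quot.sound ⟨e, he, rfl, rfl⟩
    simp [boundary_zero_toChain, φ, Chain.lift_toChain, hr]
  have hφ : φ c = 0 := by
    have h1 : n • φ c = 0 := by rw [← map_smul]; exact hφM h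
    exact (smul_eq_zero.1 h1).resolve_left hn
  rw [← Submodule.ker_mkQ M, LinearMap.mem_ker, ← hψφ, LinearMap.comp_apply, hφ, map_zero]

/-- If `H_1(X) = 0`, then a nonsingular square submatrix of `[∂_2]` that contains every column
is unimodular. -/
theorem isUnit_det_submatrix_boundaryMatrix (hX : Subsingleton (X.Homology 1))
    (o₁ : X.Orientation 1) (o₂ : X.Orientation 2) {ι : Type*} [Fintype ι] [DecidableEq ι]
    {e : ι → X.Simplex 1} (he : e.Injective) {t : ι → X.Simplex 2} (ht : t.Bijective)
    (hdet : ((X.boundaryMatrix 1 o₁ o₂).submatrix e t).det ≠ 0) :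
    IsUnit ((X.boundaryMatrix 1 o₁ o₂).submatrix e t).det := by
  classical
  set B := (X.boundaryMatrix 1 o₁ o₂).submatrix e t with hB
  have hrepr : ∀ (x : ι → ℤ) (i : ι),
      o₁.basis.repr (X.boundary 1 (∑ j, x j • o₂.basis (t j))) (e i) = (B.mulVec x) i := by
    intro x i
    simp only [map_sum, map_smul, Finsupp.coe_finsetSum, Finset.sum_apply, Finsupp.smul_apply,
      Matrix.mulVec, dotProduct, hB, Matrix.submatrix_apply, boundaryMatrix, Matrix.of_apply,
      smul_eq_mul]
    exact Finset.sum_congr rfl fun j _ => mul_comm _ _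
  -- The determinant is a unit once `B x = y` has an integral solution for every integral `y`.
  rw [← Matrix.isUnit_iff_isUnit_det, ← Matrix.mulVec_surjective_iff_isUnit]
  intro y
  set Y : X.Chain 1 := ∑ i, y i • o₁.basis (e i) with hY
  have hYrepr : ∀ i, o₁.basis.repr Y (e i) = y i := by
    intro i
    simp only [hY, map_sum, map_smul, Module.Basis.repr_self, Finsupp.coe_finsetSum,
      Finset.sum_apply, Finsupp.smul_apply, smul_eq_mul, Finsupp.single_apply, he.eq_iff]
    simp
  -- The adjugate solves `B x = det B • y` integrally, so `Z` has no coefficient on the row edges.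
  set C : X.Chain 2 := ∑ j, (B.adjugate.mulVec y) j • o₂.basis (t j)
  set Z : X.Chain 1 := X.boundary 1 C - B.det • Y with hZ
  have hZrepr : ∀ i, o₁.basis.repr Z (e i) = 0 := by
    intro i
    rw [hZ, map_sub, map_smul, Finsupp.sub_apply, Finsupp.smul_apply, hrepr, hYrepr,
      Matrix.mulVec_mulVec, Matrix.mul_adjugate, Matrix.smul_mulVec, Matrix.one_mulVec]
    simp
  -- the chosen orderings of the edges that index no row
  set O : Set (X.Ordering 1) := (fun s => (o₁ s).1) '' (Set.range e)ᶜ with hO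
  have himage : (fun f : X.Ordering 1 => X.boundary 0 f.toChain) '' O =
      X.boundary 0 '' (o₁.basis '' (Set.range e)ᶜ) := by
    simp only [hO, Set.image_image, Orientation.basis_apply]
  have hZmem : Z ∈ Submodule.span ℤ (o₁.basis '' (Set.range e)ᶜ) := by
    rw [Module.Basis.mem_span_image]
    rintro s hs ⟨i, rfl⟩
    exact Finsupp.mem_support_iff.1 hs (hZrepr i)
  have hYmem : X.boundary 0 Y ∈
      Submodule.span ℤ ((fun f : X.Ordering 1 => X.boundary 0 f.toChain) '' O) := by
    refine mem_span_boundary_of_smul_mem hdet ?_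
    have h1 : B.det • X.boundary 0 Y = -X.boundary 0 Z := by
      have h2 : X.boundary 0 (X.boundary 1 C) = 0 :=
        LinearMap.congr_fun (X.boundary_comp_boundary 0) C
      rw [hZ, map_sub, h2, map_smul, zero_sub, neg_neg]
    rw [h1, himage, ← Submodule.map_span]
    exact neg_mem (Submodule.mem_map_of_mem hZmem)
  rw [himage, ← Submodule.map_span] at hYmem
  obtain ⟨W, hW, hWY⟩ := hYmem
  have hWrepr : ∀ i, o₁.basis.repr W (e i) = 0 := by
    intro i
    by_contra hne
    exact (o₁.basis.mem_span_image.1 hW) (Finsupp.mem_support_iff.2 hne) ⟨i, rfl⟩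
  have hcyc : Y - W ∈ X.cycles 1 := by
    change Y - W ∈ LinearMap.ker (X.boundary 0)
    rw [LinearMap.mem_ker, map_sub, hWY, sub_self]
  obtain ⟨C', hC'⟩ : Y - W ∈ X.boundaries 1 := by
    have h1 := Submodule.Quotient.subsingleton_iff.1 hX
    have h2 : (⟨Y - W, hcyc⟩ : X.cycles 1) ∈ (X.boundaries 1).submoduleOf (X.cycles 1) := by
      rw [h1]; trivial
    exact h2
  -- Surjectivity of `t` is essential here: `C'` may involve any triangle of the complex, so all of
  -- them must be columns.
  have hsum : ∑ j, o₂.basis.repr C' (t j) • o₂.basis (t j) = C' := by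
    let := Fintype.ofBijective t ht
    rw [ht.sum_comp fun s => o₂.basis.repr C' s • o₂.basis s]
    exact o₂.basis.sum_repr C'
  refine ⟨fun j => o₂.basis.repr C' (t j), funext fun i => ?_⟩
  rw [← hrepr, hsum, hC', map_sub, Finsupp.sub_apply, hYrepr, hWrepr, sub_zero]

/-! ### Restriction of boundary matrices to subcomplexes -/

/-- An ordering of a simplex of a subcomplex, as an ordering in the larger complex. -/
def Ordering.ofLE {d : ℕ} (h : L ≤ X) (f : L.Ordering d) : X.Ordering d :=
  ⟨f.1, h f.2⟩

/-- A simplex of a subcomplex, as a simplex of the larger complex. -/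
def Simplex.ofLE {d : ℕ} (h : L ≤ X) (s : L.Simplex d) : X.Simplex d :=
  ⟨s.1, h s.2.1, s.2.2⟩

theorem Simplex.ofLE_injective {d : ℕ} (h : L ≤ X) :
    Function.Injective (Simplex.ofLE h : L.Simplex d → X.Simplex d) := fun _ _ hst =>
  Subtype.ext (congrArg Subtype.val hst :)

/-- The restriction of an orientation to a subcomplex. -/
def Orientation.restrict {d : ℕ} (h : L ≤ X) (o : X.Orientation d) : L.Orientation d :=
  fun s =>
    have hs : support (o (s.ofLE h)).1.1 = s.1 := congrArg Subtype.val (o (s.ofLE h)).2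
    ⟨⟨(o (s.ofLE h)).1.1, by rw [hs]; exact s.2.1⟩, Subtype.ext hs⟩

theorem Orientation.relPerm_restrict {d : ℕ} (h : L ≤ X) (o : X.Orientation d)
    (f : L.Ordering d) : (o.restrict h).relPerm f = o.relPerm (f.ofLE h) := by
  apply Orientation.relPerm_eq
  refine Subtype.ext ?_
  exact (congrArg Subtype.val (o.perm_relPerm (f.ofLE h)) :)

theorem boundaryMatrix_apply (d : ℕ) (o : X.Orientation d) (o' : X.Orientation (d + 1))
    (s : X.Simplex d) (t : X.Simplex (d + 1)) :
    X.boundaryMatrix d o o' s t = ∑ i : Fin (d + 2), (-1 : ℤ) ^ (i : ℕ) *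
      Finsupp.single ((o' t).1.delete i).simplex
        (Equiv.Perm.sign (o.relPerm ((o' t).1.delete i)) : ℤ) s := by
  have hrepr : ∀ f : X.Ordering d, o.basis.repr f.toChain =
      Finsupp.single f.simplex (Equiv.Perm.sign (o.relPerm f) : ℤ) := by
    intro f
    change o.repr _ = _
    rw [Orientation.repr, Chain.lift_toChain]
  rw [boundaryMatrix, Matrix.of_apply, Orientation.basis_apply, boundary_toChain]
  simp only [map_sum, map_smul, Finsupp.coe_finsetSum, Finset.sum_apply, Finsupp.smul_apply,
    smul_eq_mul, hrepr]

/-- Incidence signs depend only on the chosen orderings, which restriction keeps. -/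
theorem boundaryMatrix_restrict (h : L ≤ X) (d : ℕ) (o : X.Orientation d)
    (o' : X.Orientation (d + 1)) (s : L.Simplex d) (t : L.Simplex (d + 1)) :
    L.boundaryMatrix d (o.restrict h) (o'.restrict h) s t =
      X.boundaryMatrix d o o' (s.ofLE h) (t.ofLE h) := by
  classical
  rw [boundaryMatrix_apply, boundaryMatrix_apply]
  refine Finset.sum_congr rfl fun i _ => ?_
  rw [Orientation.relPerm_restrict, Finsupp.single_apply, Finsupp.single_apply]
  have hs : ((o' (t.ofLE h)).1.delete i).simplex =
      (((o'.restrict h) t).1.delete i).simplex.ofLE h := rfl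
  rw [hs, (Simplex.ofLE_injective h).eq_iff]
  rfl

theorem subset_of_boundaryMatrix_ne_zero (d : ℕ) (o : X.Orientation d)
    (o' : X.Orientation (d + 1)) (s : X.Simplex d) (t : X.Simplex (d + 1))
    (h : X.boundaryMatrix d o o' s t ≠ 0) : s.1 ⊆ t.1 := by
  classical
  rw [boundaryMatrix_apply] at h
  obtain ⟨i, -, hi⟩ := Finset.exists_ne_zero_of_sum_ne_zero h
  have hs : ((o' t).1.delete i).simplex = s := by
    by_contra hne
    exact hi (by rw [Finsupp.single_eq_of_ne' hne, mul_zero])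
  have ht : support (o' t).1.1 = t.1 := congrArg Subtype.val (o' t).2
  rw [← hs, ← ht]
  intro v hv
  obtain ⟨j, -, rfl⟩ := Finset.mem_map.1 hv
  exact Finset.mem_map.2 ⟨i.succAbove j, Finset.mem_univ _, rfl⟩

/-! ### Pure complexes generated by simplices of equal dimension -/

/-- The complex of all nonempty subsets of the members of a family of finite sets. -/
def generated {ι : Type*} (t : ι → Finset V) : PreAbstractSimplicialComplex V where
  faces := {s | s.Nonempty ∧ ∃ i, s ⊆ t i}
  isRelLowerSet_faces := fun _ ⟨hs, i, hi⟩ =>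
    ⟨hs, fun _ hr hne => ⟨hne, i, subset_trans hr hi⟩⟩

theorem generated_le {ι : Type*} {t : ι → Finset V} (ht : ∀ i, t i ∈ X.faces) :
    generated t ≤ X := fun _ ⟨hs, i, hi⟩ => (X.isRelLowerSet_faces (ht i)).2 hi hs

theorem mem_generated {ι : Type*} {t : ι → Finset V} {d : ℕ} (ht : ∀ i, (t i).card = d + 1)
    (i : ι) : t i ∈ (generated t).faces :=
  ⟨Finset.card_pos.1 (by rw [ht]; exact Nat.succ_pos d), i, subset_rfl⟩

theorem generated_isPure {ι : Type*} {t : ι → Finset V} {d : ℕ}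
    (ht : ∀ i, (t i).card = d + 1) : (generated t).IsPure := by
  have hcard : ∀ s, (generated t).IsFacet s → s.card = d + 1 := by
    intro s hs
    obtain ⟨-, i, hi⟩ := hs.prop
    rw [hs.eq_of_le (mem_generated ht i) hi, ht]
  intro s r hs hr
  rw [simplexDim, simplexDim, hcard s hs, hcard r hr]

theorem generated_hasDim {ι : Type*} [Nonempty ι] {t : ι → Finset V} {d : ℕ}
    (ht : ∀ i, (t i).card = d + 1) : (generated t).HasDim d := by
  refine ⟨?_, ?_⟩
  · obtain ⟨i⟩ := ‹Nonempty ι›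
    exact ⟨t i, mem_generated ht i, by simp [simplexDim, ht]⟩
  · rintro _ ⟨s, ⟨-, i, hi⟩, rfl⟩
    have h1 := Finset.card_le_card hi
    rw [ht] at h1
    simp only [simplexDim]
    omega

end PreAbstractSimplicialComplex

end

open PreAbstractSimplicialComplex in
theorem mainTheorem10 {V : Type*} (X : PreAbstractSimplicialComplex V)
    (hpure : X.IsPure) (hdim : X.HasDim 2)
    (hX : ∀ L : PreAbstractSimplicialComplex V, L ≤ X → L.IsPure → L.HasDim 2 →
      Subsingleton (L.Homology 1))
    (o₁ : X.Orientation 1) (o₂ : X.Orientation 2) :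
    (X.boundaryMatrix 1 o₁ o₂).IsTotallyUnimodular := by
  intro k e t he ht
  by_cases hdet : ((X.boundaryMatrix 1 o₁ o₂).submatrix e t).det = 0
  · exact ⟨0, by simp [hdet]⟩
  suffices h : IsUnit ((X.boundaryMatrix 1 o₁ o₂).submatrix e t).det by
    rcases Int.isUnit_iff.1 h with h | h
    · exact ⟨1, by simp [h]⟩
    · exact ⟨-1, by simp [h]⟩
  -- With no columns the generated complex is empty and not of dimension 2, so the empty determinant
  -- is treated apart.
  rcases isEmpty_or_nonempty (Fin k) with hk | hk
  · rw [Matrix.det_isEmpty]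
    exact isUnit_one
  have hcard : ∀ j, (t j).1.card = 2 + 1 := fun j => (t j).2.2
  set L := generated fun j => (t j).1 with hL
  have hLX : L ≤ X := generated_le fun j => (t j).2.1
  have heL : ∀ i, (e i).1 ∈ L.faces := by
    intro i
    -- A nonzero determinant has no zero row, so each row edge is a face of some column triangle.
    obtain ⟨j, hj⟩ : ∃ j, X.boundaryMatrix 1 o₁ o₂ (e i) (t j) ≠ 0 := by
      by_contra! h
      exact hdet (Matrix.det_eq_zero_of_row_eq_zero i h)
    exact ⟨(X.isRelLowerSet_faces (e i).2.1).1, j, subset_of_boundaryMatrix_ne_zero _ _ _ _ _ hj⟩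
  let e' : Fin k → L.Simplex 1 := fun i => ⟨(e i).1, heL i, (e i).2.2⟩
  let t' : Fin k → L.Simplex 2 := fun j => ⟨(t j).1, mem_generated hcard j, (t j).2.2⟩
  have he' : e'.Injective := fun i j hij => he (Subtype.ext (congrArg Subtype.val hij :))
  have ht' : t'.Bijective := by
    refine ⟨fun i j hij => ht (Subtype.ext (congrArg Subtype.val hij :)), ?_⟩
    -- A three-element face lying in a column triangle equals it.
    rintro ⟨s, ⟨hs, j, hj⟩, hs'⟩
    refine ⟨j, Subtype.ext ?_⟩
    exact (Finset.eq_of_subset_of_card_le hj (by rw [hcard, hs'])).symm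
  have hB : (L.boundaryMatrix 1 (o₁.restrict hLX) (o₂.restrict hLX)).submatrix e' t' =
      (X.boundaryMatrix 1 o₁ o₂).submatrix e t := by
    ext i j
    exact boundaryMatrix_restrict hLX 1 o₁ o₂ (e' i) (t' j)
  rw [← hB] at hdet ⊢
  exact isUnit_det_submatrix_boundaryMatrix
    (hX L hLX (generated_isPure hcard) (generated_hasDim hcard)) _ _ he' ht' hdet
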